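/- For $r>0$ and $\mu>0$ let $$S(r)=\sum_{n=1}^\infty\frac{2n}{(n^2+r^2)^2},\qquad S_\mu(r)=\sum_{n=1}^\infty\frac{2n}{(n^2+r^2)^{\mu+1}},\qquad C_\mu(r)=\frac{\sqrt{\pi}}{(2r)^{\mu-1/2}\,\Gamma(\mu+1)},$$ and for $s>1$ let $\zeta(s)=\sum_{n=1}^\infty n^{-s}$. Let $p>1$. Then for all $r\in(0,\infty)$: 1. if $\mu\ge 1$, then $$S_\mu(r)^p\le C_\mu(r)^p\,\Gamma(\mu+\tfrac12)^{p-1}\,\zeta(\mu+\tfrac12)^{p-1}\,\Gamma(p+\mu+\tfrac12)\,\zeta(p+\mu+\tfrac12);$$ 2. if $\mu\ge \tfrac32$, then $$S_\mu(r)^p\le \frac{C_\mu(r)^p}{2^{p/2}}\,\Gamma(\mu+\tfrac12)^{p-1}\,\zeta(\mu+\tfrac12)^{p-1}\,\Gamma(p+\mu+\tfrac12)\,\zeta(p+\mu+\tfrac12).$$ Moreover, for all $r\in(0,\infty)$, $$S(r)\le\frac{\sqrt{15\,\pi\,\zeta(3/2)\,\zeta(7/2)}}{4\sqrt{2r}}\,\pi\qquad\text{and}\qquad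 S_{3/2}(r)\le\frac{\pi^3}{9\sqrt{10}\,r^2}.$$ -/

import Mathlib

namespace Mathieu

noncomputable section

/-- The Mathieu series `S(r) = ∑_{n ≥ 1} 2n / (n² + r²)²`. -/
def S (r : ℝ) : ℝ :=
  ∑' n : ℕ, 2 * ((n : ℝ) + 1) / (((n : ℝ) + 1) ^ 2 + r ^ 2) ^ 2

/-- The generalized Mathieu series `S_μ(r) = ∑_{n ≥ 1} 2n / (n² + r²)^(μ + 1)`. -/
def Sgen (μ r : ℝ) : ℝ :=
  ∑' n : ℕ, 2 * ((n : ℝ) + 1) / (((n : ℝ) + 1) ^ 2 + r ^ 2) ^ (μ + 1)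

/-- The coefficient `C_μ(r) = √π / ((2r)^(μ - 1/2) Γ(μ + 1))`. -/
def C (μ r : ℝ) : ℝ :=
  Real.sqrt Real.pi / ((2 * r) ^ (μ - 1 / 2) * Real.Gamma (μ + 1))

/-- The series `ζ(s) = ∑_{n ≥ 1} 1 / n^s` for real `s` (used only for `s > 1`). -/
def zeta (s : ℝ) : ℝ :=
  ∑' n : ℕ, 1 / ((n : ℝ) + 1) ^ s

/-- For real `s > 1` the series is Mathlib's Riemann zeta function. -/
theorem ofReal_zeta {s : ℝ} (hs : 1 < s) : ((zeta s : ℝ) : ℂ) = riemannZeta (s : ℂ) := by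
  rw [zeta_eq_tsum_one_div_nat_add_one_cpow (by simpa using hs), zeta, Complex.ofReal_tsum]
  refine tsum_congr fun n => ?_
  have h : (0 : ℝ) ≤ (n : ℝ) + 1 := by positivity
  push_cast [Complex.ofReal_cpow h]
  rfl

/-- The series defining `S_μ(r)` converges for every `μ > 0`. -/
theorem summable_Sgen {μ : ℝ} (hμ : 0 < μ) (r : ℝ) :
    Summable fun n : ℕ => 2 * ((n : ℝ) + 1) / (((n : ℝ) + 1) ^ 2 + r ^ 2) ^ (μ + 1) := by
  have h1 : Summable fun n : ℕ => 2 * (1 / ((n + 1 : ℕ) : ℝ) ^ (2 * μ + 1)) :=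
    ((summable_nat_add_iff 1).2
      (Real.summable_one_div_nat_rpow.2 (by linarith : 1 < 2 * μ + 1))).mul_left 2
  refine Summable.of_nonneg_of_le (fun n => by positivity) (fun n => ?_) h1
  have h : (0 : ℝ) < (n : ℝ) + 1 := by positivity
  have h2 : ((n : ℝ) + 1) ^ (2 * μ + 1) * ((n : ℝ) + 1)
      ≤ (((n : ℝ) + 1) ^ 2 + r ^ 2) ^ (μ + 1) := by
    have e : ((n : ℝ) + 1) ^ (2 * μ + 1) * ((n : ℝ) + 1)
        = (((n : ℝ) + 1) ^ 2) ^ (μ + 1) := by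
      rw [← Real.rpow_natCast, ← Real.rpow_mul h.le, ← Real.rpow_add_one h.ne']
      congr 1
      push_cast
      ring
    rw [e]
    exact Real.rpow_le_rpow (by positivity) (by nlinarith [sq_nonneg r]) (by linarith)
  push_cast
  rw [mul_one_div, div_le_div_iff₀ (by positivity) (by positivity)]
  nlinarith

/-- The Mathieu series is the case `μ = 1` of the generalized series. -/
theorem Sgen_one (r : ℝ) : Sgen 1 r = S r := by
  unfold Sgen S
  refine tsum_congr fun n => ?_
  norm_num

end

end Mathieu

namespace Mathieu

/-! With s = μ + 1/2, everything reduces to the linear bound S_μ(r) ≤ k C_μ(r) Γ(s+1) ζ(s+1). Since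
Γ and ζ are log-convex and s+1 = ((p-1)/p) s + (1/p)(s+p), its p-th power splits into the stated
product (`Sgen_rpow_le`). The linear bound is termwise (`Sgen_le_of_forall`): 2rN ≤ N² + r² and N² ≤
N² + r² bound each summand by a multiple of N^(-(s+1)), and √s Γ(s+1/2) ≤ Γ(s+1) absorbs the
constant. Part 1 takes k = 1, part 2 takes k = 1/√2. -/

theorem summable_zeta {s : ℝ} (hs : 1 < s) : Summable fun n : ℕ => 1 / ((n : ℝ) + 1) ^ s := by
  have h := (summable_nat_add_iff 1).2 (Real.summable_one_div_nat_rpow.2 hs)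
  simpa using h

theorem zeta_nonneg (s : ℝ) : 0 ≤ zeta s :=
  tsum_nonneg fun n => by positivity

theorem C_nonneg {μ r : ℝ} (hμ : 0 < μ) (hr : 0 < r) : 0 ≤ C μ r := by
  have := Real.Gamma_pos_of_pos (by linarith : 0 < μ + 1)
  unfold C
  positivity

theorem Sgen_nonneg (μ r : ℝ) : 0 ≤ Sgen μ r :=
  tsum_nonneg fun n => by positivity

/-- Logarithmic convexity of the zeta function. -/
theorem zeta_add_one_rpow_le {s p : ℝ} (hs : 1 < s) (hp : 1 < p) :
    zeta (s + 1) ^ p ≤ zeta s ^ (p - 1) * zeta (s + p) := by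
  have hp0 : p ≠ 0 := by linarith
  have hp1 : p - 1 ≠ 0 := by linarith
  have hpq : p.HolderConjugate (p / (p - 1)) := Real.HolderConjugate.conjExponent hp
  -- Hölder with s + 1 = (s+p)/p + s(p-1)/p.
  let f : ℕ → ℝ := fun n => ((n : ℝ) + 1) ^ (-((s + p) / p))
  let g : ℕ → ℝ := fun n => ((n : ℝ) + 1) ^ (-(s * (p - 1) / p))
  have hf : ∀ n, f n ^ p = 1 / ((n : ℝ) + 1) ^ (s + p) := fun n => by
    have h : (0 : ℝ) ≤ (n : ℝ) + 1 := by positivity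
    rw [← Real.rpow_mul h, one_div, ← Real.rpow_neg h]
    congr 1
    field_simp
  have hg : ∀ n, g n ^ (p / (p - 1)) = 1 / ((n : ℝ) + 1) ^ s := fun n => by
    have h : (0 : ℝ) ≤ (n : ℝ) + 1 := by positivity
    rw [← Real.rpow_mul h, one_div, ← Real.rpow_neg h]
    congr 1
    field_simp
  have hfg : ∀ n, f n * g n = 1 / ((n : ℝ) + 1) ^ (s + 1) := fun n => by
    have h : (0 : ℝ) < (n : ℝ) + 1 := by positivity
    rw [← Real.rpow_add h, one_div, ← Real.rpow_neg h.le]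
    congr 1
    field_simp
    ring
  have key := Real.inner_le_Lp_mul_Lq_tsum_of_nonneg hpq (f := f) (g := g)
    (fun n => by positivity) (fun n => by positivity)
    (by simpa only [hf] using summable_zeta (by linarith : 1 < s + p))
    (by simpa only [hg] using summable_zeta hs)
  simp only [hf, hg, hfg] at key
  change zeta (s + 1) ≤ zeta (s + p) ^ (1 / p) * zeta s ^ (1 / (p / (p - 1))) at key
  have h1 := zeta_nonneg s
  have h2 := zeta_nonneg (s + p)
  calc zeta (s + 1) ^ p
      ≤ (zeta (s + p) ^ (1 / p) * zeta s ^ (1 / (p / (p - 1)))) ^ p :=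
        Real.rpow_le_rpow (zeta_nonneg _) key (by linarith)
    _ = zeta s ^ (p - 1) * zeta (s + p) := by
        rw [Real.mul_rpow (by positivity) (by positivity), ← Real.rpow_mul h1, ← Real.rpow_mul h2,
          one_div_mul_cancel hp0, Real.rpow_one, mul_comm]
        congr 2
        field_simp

/-- Logarithmic convexity of the Gamma function. -/
theorem Gamma_add_one_rpow_le {s p : ℝ} (hs : 0 < s) (hp : 1 < p) :
    Real.Gamma (s + 1) ^ p ≤ Real.Gamma s ^ (p - 1) * Real.Gamma (s + p) := by
  have hp0 : p ≠ 0 := by linarith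
  have key := Real.Gamma_mul_add_mul_le_rpow_Gamma_mul_rpow_Gamma hs (by linarith : 0 < s + p)
    (a := (p - 1) / p) (b := 1 / p) (div_pos (by linarith) (by linarith)) (by positivity)
    (by field_simp; ring)
  have e : (p - 1) / p * s + 1 / p * (s + p) = s + 1 := by
    field_simp
    ring
  rw [e] at key
  have h1 := (Real.Gamma_pos_of_pos hs).le
  have h2 := (Real.Gamma_pos_of_pos (by linarith : 0 < s + p)).le
  calc Real.Gamma (s + 1) ^ p
      ≤ (Real.Gamma s ^ ((p - 1) / p) * Real.Gamma (s + p) ^ (1 / p)) ^ p :=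
        Real.rpow_le_rpow (Real.Gamma_pos_of_pos (by linarith)).le key (by linarith)
    _ = Real.Gamma s ^ (p - 1) * Real.Gamma (s + p) := by
        rw [Real.mul_rpow (by positivity) (by positivity), ← Real.rpow_mul h1, ← Real.rpow_mul h2,
          one_div_mul_cancel hp0, Real.rpow_one, div_mul_cancel₀ _ hp0]

/-- A lower bound for a ratio of Gamma values at distance one half. -/
theorem sqrt_mul_Gamma_le {x : ℝ} (hx : 0 < x) :
    √x * Real.Gamma (x + 1 / 2) ≤ Real.Gamma (x + 1) := by
  -- Log-convexity at the midpoint of x and x + 1.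
  have key := Real.Gamma_mul_add_mul_le_rpow_Gamma_mul_rpow_Gamma hx (by linarith : 0 < x + 1)
    (a := 1 / 2) (b := 1 / 2) (by norm_num) (by norm_num) (by norm_num)
  have e : 1 / 2 * x + 1 / 2 * (x + 1) = x + 1 / 2 := by ring
  have h := Real.Gamma_pos_of_pos hx
  rw [e, ← Real.sqrt_eq_rpow, ← Real.sqrt_eq_rpow, Real.Gamma_add_one hx.ne',
    Real.sqrt_mul hx.le] at key
  rw [Real.Gamma_add_one hx.ne']
  calc √x * Real.Gamma (x + 1 / 2)
      ≤ √x * (√(Real.Gamma x) * (√x * √(Real.Gamma x))) := by gcongr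
    _ = (√x * √x) * (√(Real.Gamma x) * √(Real.Gamma x)) := by ring
    _ = x * Real.Gamma x := by rw [Real.mul_self_sqrt hx.le, Real.mul_self_sqrt h.le]

theorem pow_three_le_rpow (N r : ℝ) (hN : 0 < N) : N ^ 3 ≤ (N ^ 2 + r ^ 2) ^ (3 / 2 : ℝ) := by
  have e : N ^ 3 = (N ^ 2) ^ (3 / 2 : ℝ) := by
    rw [← Real.rpow_natCast, ← Real.rpow_natCast, ← Real.rpow_mul hN.le]
    norm_num
  rw [e]
  exact Real.rpow_le_rpow (by positivity) (by nlinarith [sq_nonneg r]) (by norm_num)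

theorem rpow_mul_rpow_le {μ r N : ℝ} (hμ : 1 ≤ μ) (hr : 0 < r) (hN : 0 < N) :
    N * ((2 * r) ^ (μ - 1 / 2) * N ^ (μ + 3 / 2)) ≤ (N ^ 2 + r ^ 2) ^ (μ + 1) := by
  have hD : 0 < N ^ 2 + r ^ 2 := by positivity
  calc N * ((2 * r) ^ (μ - 1 / 2) * N ^ (μ + 3 / 2))
      = (2 * r * N) ^ (μ - 1 / 2) * N ^ 3 := by
        rw [Real.mul_rpow (by positivity) hN.le,
          show μ + 3 / 2 = (μ - 1 / 2) + (2 : ℕ) by push_cast; ring, Real.rpow_add_natCast hN.ne']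
        ring
    _ ≤ (N ^ 2 + r ^ 2) ^ (μ - 1 / 2) * (N ^ 2 + r ^ 2) ^ (3 / 2 : ℝ) := by
        gcongr
        · linarith
        · nlinarith [sq_nonneg (N - r)]
        · exact pow_three_le_rpow N r hN
    _ = (N ^ 2 + r ^ 2) ^ (μ + 1) := by
        rw [← Real.rpow_add hD]
        congr 1
        ring

/-- One factor 2rN is kept out of the AM-GM step and paired with N², where equality in AM-GM is not
extremal. The best constant there is 3√3/8; 4/5 is enough for k = 1/√2, whereas 1 would fail at μ =
3/2. -/
theorem rpow_mul_rpow_le' {μ r N : ℝ} (hμ : 3 / 2 ≤ μ) (hr : 0 < r) (hN : 0 < N) :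
    N * ((2 * r) ^ (μ - 1 / 2) * N ^ (μ + 3 / 2)) ≤ 4 / 5 * (N ^ 2 + r ^ 2) ^ (μ + 1) := by
  have hD : 0 < N ^ 2 + r ^ 2 := by positivity
  have h : 2 * r * N * N ^ 2 ≤ 4 / 5 * (N ^ 2 + r ^ 2) ^ 2 := by
    nlinarith [mul_nonneg (sq_nonneg N) (sq_nonneg (N - 5 / 4 * r)), sq_nonneg (r ^ 2),
      mul_nonneg (sq_nonneg N) (sq_nonneg r)]
  have h3 : N ≤ (N ^ 2 + r ^ 2) ^ (1 / 2 : ℝ) := by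
    rw [← Real.sqrt_eq_rpow]
    exact Real.le_sqrt_of_sq_le (by nlinarith [sq_nonneg r])
  calc N * ((2 * r) ^ (μ - 1 / 2) * N ^ (μ + 3 / 2))
      = (2 * r * N) ^ (μ - 3 / 2) * ((2 * r * N * N ^ 2) * N) := by
        rw [Real.mul_rpow (by positivity) hN.le,
          show μ + 3 / 2 = (μ - 3 / 2) + (3 : ℕ) by push_cast; ring, Real.rpow_add_natCast hN.ne',
          show μ - 1 / 2 = (μ - 3 / 2) + 1 by ring, Real.rpow_add_one (by positivity)]
        ring
    _ ≤ (N ^ 2 + r ^ 2) ^ (μ - 3 / 2) *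
          ((4 / 5 * (N ^ 2 + r ^ 2) ^ 2) * (N ^ 2 + r ^ 2) ^ (1 / 2 : ℝ)) := by
        gcongr
        nlinarith [sq_nonneg (N - r)]
    _ = 4 / 5 * (N ^ 2 + r ^ 2) ^ (μ + 1) := by
        rw [show μ + 1 = (μ - 3 / 2) + (2 : ℕ) + 1 / 2 by push_cast; ring, Real.rpow_add hD,
          Real.rpow_add_natCast hD.ne']
        ring

/-- Termwise comparison of `S_μ(r)` with `ζ(μ + 3/2)`. -/
theorem Sgen_le_of_forall {μ r c k : ℝ} (hμ : 0 < μ) (hr : 0 < r)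
    (hterm : ∀ N : ℝ, 0 < N →
      N * ((2 * r) ^ (μ - 1 / 2) * N ^ (μ + 3 / 2)) ≤ c * (N ^ 2 + r ^ 2) ^ (μ + 1))
    (hc : 2 * c ≤ k * √Real.pi * √(μ + 1 / 2)) (hk : 0 ≤ k) :
    Sgen μ r ≤ k * C μ r * (Real.Gamma (μ + 1 / 2 + 1) * zeta (μ + 1 / 2 + 1)) := by
  have hG := Real.Gamma_pos_of_pos (by linarith : 0 < μ + 1)
  have hratio := sqrt_mul_Gamma_le (by linarith : 0 < μ + 1 / 2)
  rw [show μ + 1 / 2 + 1 / 2 = μ + 1 by ring] at hratio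
  have hconst : 2 * c * Real.Gamma (μ + 1) ≤ k * √Real.pi * Real.Gamma (μ + 1 / 2 + 1) :=
    calc 2 * c * Real.Gamma (μ + 1) ≤ k * √Real.pi * √(μ + 1 / 2) * Real.Gamma (μ + 1) := by gcongr
      _ = k * √Real.pi * (√(μ + 1 / 2) * Real.Gamma (μ + 1)) := by ring
      _ ≤ _ := by gcongr
  have hsum := (summable_zeta (by linarith : 1 < μ + 1 / 2 + 1)).mul_left
    (k * C μ r * Real.Gamma (μ + 1 / 2 + 1))
  rw [← mul_assoc, zeta, ← tsum_mul_left]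
  refine (summable_Sgen hμ r).tsum_le_tsum (fun n => ?_) hsum
  have hN : (0 : ℝ) < (n : ℝ) + 1 := by positivity
  have ht := hterm _ hN
  generalize (n : ℝ) + 1 = N at hN ht ⊢
  have hA : 0 < (2 * r) ^ (μ - 1 / 2) := by positivity
  have hB : 0 < N ^ (μ + 3 / 2) := by positivity
  have hD : 0 < (N ^ 2 + r ^ 2) ^ (μ + 1) := by positivity
  rw [C, show k * (√Real.pi / ((2 * r) ^ (μ - 1 / 2) * Real.Gamma (μ + 1))) *
      Real.Gamma (μ + 1 / 2 + 1) * (1 / N ^ (μ + 1 / 2 + 1)) =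
      k * √Real.pi * Real.Gamma (μ + 1 / 2 + 1) /
        ((2 * r) ^ (μ - 1 / 2) * N ^ (μ + 3 / 2) * Real.Gamma (μ + 1)) by
    rw [show μ + 1 / 2 + 1 = μ + 3 / 2 by ring]
    field_simp, div_le_div_iff₀ hD (by positivity)]
  calc 2 * N * ((2 * r) ^ (μ - 1 / 2) * N ^ (μ + 3 / 2) * Real.Gamma (μ + 1))
      = 2 * (N * ((2 * r) ^ (μ - 1 / 2) * N ^ (μ + 3 / 2))) * Real.Gamma (μ + 1) := by ring
    _ ≤ 2 * (c * (N ^ 2 + r ^ 2) ^ (μ + 1)) * Real.Gamma (μ + 1) := by gcongr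
    _ = 2 * c * Real.Gamma (μ + 1) * (N ^ 2 + r ^ 2) ^ (μ + 1) := by ring
    _ ≤ _ := by gcongr

theorem Sgen_rpow_le {μ r k p : ℝ} (hp : 1 < p) (hμ : 1 ≤ μ) (hr : 0 < r) (hk : 0 ≤ k)
    (h : Sgen μ r ≤ k * C μ r * (Real.Gamma (μ + 1 / 2 + 1) * zeta (μ + 1 / 2 + 1))) :
    Sgen μ r ^ p ≤ k ^ p * C μ r ^ p * Real.Gamma (μ + 1 / 2) ^ (p - 1) *
      zeta (μ + 1 / 2) ^ (p - 1) * Real.Gamma (p + μ + 1 / 2) * zeta (p + μ + 1 / 2) := by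
  have hC := C_nonneg (by linarith : 0 < μ) hr
  have hz := zeta_nonneg (μ + 1 / 2 + 1)
  have hG := (Real.Gamma_pos_of_pos (by linarith : 0 < μ + 1 / 2 + 1)).le
  have hG' := (Real.Gamma_pos_of_pos (by linarith : 0 < μ + 1 / 2)).le
  have hG2 := (Real.Gamma_pos_of_pos (by linarith : 0 < μ + 1 / 2 + p)).le
  calc Sgen μ r ^ p
      ≤ (k * C μ r * (Real.Gamma (μ + 1 / 2 + 1) * zeta (μ + 1 / 2 + 1))) ^ p :=
        Real.rpow_le_rpow (Sgen_nonneg _ _) h (by linarith)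
    _ = k ^ p * C μ r ^ p * (Real.Gamma (μ + 1 / 2 + 1) ^ p * zeta (μ + 1 / 2 + 1) ^ p) := by
        rw [Real.mul_rpow (by positivity) (by positivity), Real.mul_rpow hk hC,
          Real.mul_rpow hG hz]
    _ ≤ k ^ p * C μ r ^ p *
          ((Real.Gamma (μ + 1 / 2) ^ (p - 1) * Real.Gamma (μ + 1 / 2 + p)) *
            (zeta (μ + 1 / 2) ^ (p - 1) * zeta (μ + 1 / 2 + p))) := by
        gcongr
        · exact Gamma_add_one_rpow_le (by linarith) hp
        · exact zeta_add_one_rpow_le (by linarith) hp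
    _ = _ := by
        rw [show μ + 1 / 2 + p = p + μ + 1 / 2 by ring]
        ring

theorem Sgen_rpow_le_of_one_le {μ r p : ℝ} (hp : 1 < p) (hμ : 1 ≤ μ) (hr : 0 < r) :
    Sgen μ r ^ p ≤ C μ r ^ p * Real.Gamma (μ + 1 / 2) ^ (p - 1) *
      zeta (μ + 1 / 2) ^ (p - 1) * Real.Gamma (p + μ + 1 / 2) * zeta (p + μ + 1 / 2) := by
  have h := Sgen_rpow_le hp hμ hr zero_le_one (Sgen_le_of_forall (c := 1) (by linarith) hr
    (fun N hN => by simpa using rpow_mul_rpow_le hμ hr hN) ?_ zero_le_one)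
  · simpa only [Real.one_rpow, one_mul] using h
  · rw [one_mul, ← Real.sqrt_mul Real.pi_pos.le]
    -- At the worst case μ = 1 this is 4 ≤ 3π/2.
    exact Real.le_sqrt_of_sq_le (by nlinarith [Real.pi_gt_three])

theorem Sgen_rpow_le_of_three_halves_le {μ r p : ℝ} (hp : 1 < p) (hμ : 3 / 2 ≤ μ) (hr : 0 < r) :
    Sgen μ r ^ p ≤ C μ r ^ p / 2 ^ (p / 2) * Real.Gamma (μ + 1 / 2) ^ (p - 1) *
      zeta (μ + 1 / 2) ^ (p - 1) * Real.Gamma (p + μ + 1 / 2) * zeta (p + μ + 1 / 2) := by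
  have hk : (0 : ℝ) ≤ √(1 / 2) := Real.sqrt_nonneg _
  have h := Sgen_rpow_le hp (by linarith) hr hk (Sgen_le_of_forall (c := 4 / 5) (by linarith) hr
    (fun N hN => rpow_mul_rpow_le' hμ hr hN) ?_ hk)
  · have e : √(1 / 2 : ℝ) ^ p = 1 / 2 ^ (p / 2) := by
      rw [Real.sqrt_eq_rpow, ← Real.rpow_mul (by norm_num), Real.div_rpow (by norm_num)
        (by norm_num), Real.one_rpow, one_div_mul_eq_div]
    rwa [e, one_div_mul_eq_div] at h
  · rw [← Real.sqrt_mul (by norm_num), ← Real.sqrt_mul (by positivity)]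
    -- At the worst case μ = 3/2 this is (8/5)² ≤ π.
    exact Real.le_sqrt_of_sq_le (by nlinarith [Real.pi_gt_three])

theorem S_le {r : ℝ} (hr : 0 < r) :
    S r ≤ √(15 * Real.pi * zeta (3 / 2) * zeta (7 / 2)) / (4 * √(2 * r)) * Real.pi := by
  -- The case p = 2, μ = 1 is stronger than needed: the squared target exceeds it by a factor π.
  have h := Sgen_rpow_le_of_one_le one_lt_two le_rfl hr
  have h32 : Real.Gamma (3 / 2) = √Real.pi / 2 := by
    rw [show (3 / 2 : ℝ) = 1 / 2 + 1 by norm_num, Real.Gamma_add_one (by norm_num),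
      Real.Gamma_one_half_eq]
    ring
  have h72 : Real.Gamma (7 / 2) = 15 * √Real.pi / 8 := by
    rw [show (7 / 2 : ℝ) = 3 / 2 + 1 + 1 by norm_num, Real.Gamma_add_one (by norm_num),
      Real.Gamma_add_one (by norm_num), h32]
    ring
  have h2 : Real.Gamma 2 = 1 := by simp
  norm_num [Sgen_one, C, h32, h72, h2, ← Real.sqrt_eq_rpow] at h
  have hz : 0 ≤ zeta (3 / 2) * zeta (7 / 2) := mul_nonneg (zeta_nonneg _) (zeta_nonneg _)
  refine le_of_sq_le_sq (h.trans ?_) (by positivity)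
  rw [← Real.sqrt_mul zero_le_two, mul_pow, div_pow, div_pow, mul_pow, Real.sq_sqrt (by positivity),
    Real.sq_sqrt (by positivity), Real.sq_sqrt (by
      rw [mul_assoc]
      positivity)]
  calc Real.pi / (2 * r) * (√Real.pi / 2) * zeta (3 / 2) * (15 * √Real.pi / 8) * zeta (7 / 2)
      = √Real.pi ^ 2 * Real.pi * 15 * (zeta (3 / 2) * zeta (7 / 2)) / (32 * r) * 1 := by
        field_simp
        ring
    _ ≤ √Real.pi ^ 2 * Real.pi * 15 * (zeta (3 / 2) * zeta (7 / 2)) / (32 * r) * Real.pi :=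
        mul_le_mul_of_nonneg_left (by linarith [Real.pi_gt_three]) (by positivity)
    _ = _ := by
        rw [Real.sq_sqrt Real.pi_pos.le]
        field_simp
        ring

/-- Independent of the p-th power bounds: 4N²r² ≤ (N² + r²)² compares the series directly with ζ(2)
= π²/6, giving π²/(12r²), and 9√10 ≤ 36 ≤ 12π finishes. -/
theorem Sgen_three_halves_le {r : ℝ} (hr : 0 < r) :
    Sgen (3 / 2) r ≤ Real.pi ^ 3 / (9 * √10 * r ^ 2) := by
  have hz : HasSum (fun n : ℕ => 1 / ((n : ℝ) + 1) ^ 2) (Real.pi ^ 2 / 6) := by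
    simpa using (hasSum_nat_add_iff' 1).2 hasSum_zeta_two
  have hle : Sgen (3 / 2) r ≤ 1 / (2 * r ^ 2) * (Real.pi ^ 2 / 6) := by
    rw [← hz.tsum_eq, ← tsum_mul_left]
    refine (summable_Sgen (by norm_num) r).tsum_le_tsum (fun n => ?_) (hz.summable.mul_left _)
    have hN : (0 : ℝ) < (n : ℝ) + 1 := by positivity
    generalize (n : ℝ) + 1 = N at hN ⊢
    have hD : 0 < N ^ 2 + r ^ 2 := by positivity
    have hmul : 4 * N ^ 3 * r ^ 2 ≤ (N ^ 2 + r ^ 2) ^ (3 / 2 + 1 : ℝ) :=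
      calc 4 * N ^ 3 * r ^ 2 = N * (4 * N ^ 2 * r ^ 2) := by ring
        _ ≤ (N ^ 2 + r ^ 2) ^ (1 / 2 : ℝ) * (N ^ 2 + r ^ 2) ^ 2 := by
            gcongr
            · rw [← Real.sqrt_eq_rpow]
              exact Real.le_sqrt_of_sq_le (by nlinarith [sq_nonneg r])
            · nlinarith [sq_nonneg (N ^ 2 - r ^ 2)]
        _ = (N ^ 2 + r ^ 2) ^ (3 / 2 + 1 : ℝ) := by
            rw [show (3 / 2 + 1 : ℝ) = 1 / 2 + (2 : ℕ) by norm_num,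
              Real.rpow_add_natCast hD.ne']
    rw [show 1 / (2 * r ^ 2) * (1 / N ^ 2) = 1 / (2 * r ^ 2 * N ^ 2) by field_simp,
      div_le_div_iff₀ (by positivity) (by positivity)]
    linarith
  refine hle.trans ?_
  have h10 : √10 ≤ 4 := Real.sqrt_le_iff.2 (by norm_num)
  rw [show 1 / (2 * r ^ 2) * (Real.pi ^ 2 / 6) = Real.pi ^ 2 / (12 * r ^ 2) by
      field_simp; norm_num,
    div_le_div_iff₀ (by positivity) (by positivity)]
  calc Real.pi ^ 2 * (9 * √10 * r ^ 2) = Real.pi ^ 2 * r ^ 2 * (9 * √10) := by ring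
    _ ≤ Real.pi ^ 2 * r ^ 2 * (12 * Real.pi) := by
        exact mul_le_mul_of_nonneg_left (by linarith [Real.pi_gt_three]) (by positivity)
    _ = Real.pi ^ 3 * (12 * r ^ 2) := by ring

end Mathieu

theorem mainTheorem4 :
    (∀ p μ r : ℝ, 1 < p → 0 < r →
      (1 ≤ μ →
        Mathieu.Sgen μ r ^ p ≤
          Mathieu.C μ r ^ p * Real.Gamma (μ + 1 / 2) ^ (p - 1) *
            Mathieu.zeta (μ + 1 / 2) ^ (p - 1) *
            Real.Gamma (p + μ + 1 / 2) * Mathieu.zeta (p + μ + 1 / 2)) ∧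
      (3 / 2 ≤ μ →
        Mathieu.Sgen μ r ^ p ≤
          Mathieu.C μ r ^ p / 2 ^ (p / 2) * Real.Gamma (μ + 1 / 2) ^ (p - 1) *
            Mathieu.zeta (μ + 1 / 2) ^ (p - 1) *
            Real.Gamma (p + μ + 1 / 2) * Mathieu.zeta (p + μ + 1 / 2))) ∧
    (∀ r : ℝ, 0 < r →
      Mathieu.S r ≤
        Real.sqrt (15 * Real.pi * Mathieu.zeta (3 / 2) * Mathieu.zeta (7 / 2)) /
          (4 * Real.sqrt (2 * r)) * Real.pi ∧
      Mathieu.Sgen (3 / 2) r ≤ Real.pi ^ 3 / (9 * Real.sqrt 10 * r ^ 2)) :=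
  ⟨fun _ _ _ hp hr => ⟨fun hμ => Mathieu.Sgen_rpow_le_of_one_le hp hμ hr,
      fun hμ => Mathieu.Sgen_rpow_le_of_three_halves_le hp hμ hr⟩,
    fun _ hr => ⟨Mathieu.S_le hr, Mathieu.Sgen_three_halves_le hr⟩⟩
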